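/- Let $K$ be a field and let $n,t,s$ be integers with $s\ge 1$, $t\ge 1$ and $t\le n\le 2t$. Let $R=K[x_1,\dots,x_n]$ with its standard grading, let $L_n$ be the path graph with vertices $x_1,\dots,x_n$ and edges $\{x_j,x_{j+1}\}$ for $1\le j\le n-1$, and let $I_t(L_n)\subseteq R$ be its $t$-path ideal, that is, the ideal generated by the products of the variables along the paths of $L_n$ with exactly $t$ vertices; explicitly, $I_t(L_n)=(x_ix_{i+1}\cdots x_{i+t-1} : 1\le i\le n-t+1)$. Then $$\operatorname{reg} R/I_t(L_n)^s = ts-1,$$ where $\operatorname{reg} M=\max\{j-i : \beta_{i,j}(M)\neq 0\}$ is the Castelnuovo–Mumford regularity and $\beta_{i,j}(M)$ is the number of basis elements of degree $j$ in homological degree $i$ of a minimal graded free resolution of the graded $R$-module $M$. -/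

import Mathlib

open MvPolynomial

/-- The `t`-path ideal of a simple graph `G`: the ideal of the polynomial ring `K[x_v : v ∈ V]`
generated by the products `x_{v₁} ⋯ x_{v_t}` over all paths of `G` with exactly `t` vertices
(so `t - 1` edges, and pairwise distinct vertices). -/
noncomputable def pathIdeal (K : Type*) [Field K] {V : Type*} (G : SimpleGraph V) (t : ℕ) :
    Ideal (MvPolynomial V K) :=
  Ideal.span {f | ∃ (u v : V) (p : G.Walk u v),
    p.IsPath ∧ p.length + 1 = t ∧ f = (p.support.map (X : V → MvPolynomial V K)).prod}

/-- The standard grading of `R ⧸ I`, where `R = K[x_v : v ∈ σ]` has its variables in degree one: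
the degree `j` part is the image of the homogeneous polynomials of degree `j`. -/
noncomputable def quotientGrading {K σ : Type*} [Field K] (I : Ideal (MvPolynomial σ K)) (j : ℕ) :
    Submodule K (MvPolynomial σ K ⧸ I) :=
  (homogeneousSubmodule σ K j).map (Ideal.Quotient.mkₐ K I).toLinearMap

/-- The degree `j` part of the graded free module `⨁ k, R(-a k)`, in which the basis element
indexed by `k` has degree `a k`: a vector lies in it if and only if each monomial of its
coordinate at `k` has degree `j - a k`. -/
def freeDegreePart (K : Type*) {σ ι : Type*} [Field K] (a : ι → ℕ) (j : ℕ) :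
    Set (ι →₀ MvPolynomial σ K) :=
  {v | ∀ k, ∀ m ∈ (v k).support, Finsupp.degree m + a k = j}

/-- A graded free resolution `⋯ → F 2 → F 1 → F 0 → M → 0` of an `ℕ`-graded module `M` over
`R = K[x_v : v ∈ σ]`, with `F i = ⨁ k, R(-shift i k)` of finite rank, and with all maps
`R`-linear and homogeneous of degree zero. (A resolution of finite length is continued by zero
modules.) -/
structure GradedFreeResolution {K σ M : Type*} [Field K] [AddCommGroup M] [Module K M]
    [Module (MvPolynomial σ K) M] (𝓜 : ℕ → Submodule K M) where
  /-- the index set of the homogeneous basis of `F i` -/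
  idx : ℕ → Type
  finite_idx : ∀ i, Finite (idx i)
  /-- the degrees of the homogeneous basis elements of `F i` -/
  shift : ∀ i, idx i → ℕ
  /-- the differential `F (i + 1) → F i` -/
  d : ∀ i, (idx (i + 1) →₀ MvPolynomial σ K) →ₗ[MvPolynomial σ K] (idx i →₀ MvPolynomial σ K)
  /-- the augmentation `F 0 → M` -/
  aug : (idx 0 →₀ MvPolynomial σ K) →ₗ[MvPolynomial σ K] M
  d_homogeneous : ∀ i k, d i (Finsupp.single k 1) ∈ freeDegreePart K (shift i) (shift (i + 1) k)
  aug_homogeneous : ∀ k, aug (Finsupp.single k 1) ∈ 𝓜 (shift 0 k)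
  aug_surjective : Function.Surjective aug
  exact_aug : Function.Exact (d 0) aug
  exact_d : ∀ i, Function.Exact (d (i + 1)) (d i)

/-- A graded free resolution is minimal if every differential has its image in `𝔪 F`, where `𝔪`
is the ideal generated by the variables. -/
def GradedFreeResolution.IsMinimal {K σ M : Type*} [Field K] [AddCommGroup M] [Module K M]
    [Module (MvPolynomial σ K) M] {𝓜 : ℕ → Submodule K M} (F : GradedFreeResolution (σ := σ) 𝓜) :
    Prop :=
  ∀ i, LinearMap.range (F.d i) ≤
    Ideal.span (Set.range (X : σ → MvPolynomial σ K)) •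
      (⊤ : Submodule (MvPolynomial σ K) (F.idx i →₀ MvPolynomial σ K))

/-- `HasRegularity σ 𝓜 r` says that the graded module `M` with grading `𝓜` has
Castelnuovo-Mumford regularity `r`, that is `r = max {j - i | β_{i,j}(M) ≠ 0}`, where the graded
Betti number `β_{i,j}(M)` is the number of basis elements of degree `j` in homological degree `i`
of a minimal graded free resolution of `M`. It is required that a minimal graded free resolution
exists, and that the maximum is attained and equal to `r` for each of them. -/
def HasRegularity {K M : Type*} (σ : Type*) [Field K] [AddCommGroup M] [Module K M]
    [Module (MvPolynomial σ K) M] (𝓜 : ℕ → Submodule K M) (r : ℤ) : Prop :=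
  (∃ F : GradedFreeResolution (σ := σ) 𝓜, F.IsMinimal) ∧
    ∀ F : GradedFreeResolution (σ := σ) 𝓜, F.IsMinimal →
      IsGreatest {q : ℤ | ∃ (i : ℕ) (k : F.idx i), q = (F.shift i k : ℤ) - (i : ℤ)} r

/-! The regularity is read off an explicit linear resolution, which is compared with an arbitrary
minimal one.

Write `n = t + k` with `k ≤ t`, and number the vertices from zero. A path on `t` vertices contains
`k, …, t - 1`, and for each `j < k` exactly one of `j` and `t + j`. Hence the generators of
`J = I_t(L_n) ^ s` are, up to a common factor, the monomials `∏ x_j ^ (C j) * x_{t+j} ^ (s - C j)`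
for the monotone sequences `C : Fin k → {0, …, s}` (`pathIdeal_pathGraph`, `monotoneIdeal_eq_pow`).
Ordered along a linear extension of the pointwise order, they have linear quotients: the colon ideal
at `C` is generated by the variables `x_{t+j}` for which lowering `C j` by one leaves `C` monotone
(`leadIdeal_ker_pathMap`).

Linear quotients by variables pass to syzygies. If `(g_j : j < i) : g_i` is generated by the
variables in `S i`, then the relations `x e_i - ⋯` for `x ∈ S i` generate the first syzygies, and,
ordered lexicographically, they have linear quotients again, with the colon ideal at `(i, x)`
generated by the `y ∈ S i` with `y < x` (`IsLeadingBasis.leadIdeal_ker`). Each step raises the degree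
by one, so iteration resolves `R ⧸ J` with basis elements of degree `0` in homological degree `0` and
of degree `t * s + i - 1` in homological degree `i ≥ 1` (`LinearStage.resolution`). All entries of
its matrices have positive degree, so it is minimal.

Finally, the degrees of the basis of any minimal graded free resolution `F` occur in this one, in
the same homological degree: a homogeneous comparison map `α`, a comparison map `β` back, and a
homotopy from `β α` to the identity show that `β α` is the identity modulo the variables, while `α`
vanishes modulo the variables on a basis element whose degree does not occur
(`GradedFreeResolution.IsMinimal.exists_shift_eq`). So `t * s - 1` is an upper bound, and it is
attained in homological degree one, where `F` is nonzero since `0 ≠ J ≠ R` (`nonempty_idx_one`). -/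

/-! ### Graded free modules -/

section Graded

variable {K σ ι κ : Type*} [Field K]

/-- The projection of the graded free module `⨁ k, R(-a k)` onto its degree `j` part. -/
noncomputable def freeComponent (a : ι → ℕ) (j : ℕ) :
    (ι →₀ MvPolynomial σ K) →ₗ[K] (ι →₀ MvPolynomial σ K) :=
  Finsupp.lsum K fun k => Finsupp.lsingle k ∘ₗ
    (if a k ≤ j then homogeneousComponent (j - a k) else 0)

theorem coeff_freeComponent (a : ι → ℕ) (j : ℕ) (v : ι →₀ MvPolynomial σ K) (k : ι)
    (m : σ →₀ ℕ) :
    coeff m (freeComponent a j v k) =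
      if Finsupp.degree m + a k = j then coeff m (v k) else 0 := by
  classical
  induction v using Finsupp.induction_linear with
  | zero => simp
  | add v w hv hw =>
    simp only [map_add, Finsupp.add_apply, coeff_add, hv, hw]
    split_ifs <;> simp
  | single l f =>
    by_cases hlk : l = k
    · subst hlk
      by_cases hl : a l ≤ j
      · have : Finsupp.degree m = j - a l ↔ Finsupp.degree m + a l = j := by omega
        simp [freeComponent, hl, coeff_homogeneousComponent, this]
      · have : ¬ Finsupp.degree m + a l = j := by omega
        simp [freeComponent, hl, this]
    · simp [freeComponent, hlk]

theorem mem_freeDegreePart_iff (a : ι → ℕ) (j : ℕ) (v : ι →₀ MvPolynomial σ K) :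
    v ∈ freeDegreePart K a j ↔ freeComponent a j v = v := by
  constructor
  · intro h
    ext k m
    rw [coeff_freeComponent]
    split_ifs with hm
    · rfl
    · by_contra hne
      exact hm (h k m (mem_support_iff.2 (Ne.symm hne)))
  · intro h k m hm
    rw [← h, mem_support_iff, coeff_freeComponent] at hm
    by_contra hne
    exact hm (if_neg hne)

theorem freeComponent_mem (a : ι → ℕ) (j : ℕ) (v : ι →₀ MvPolynomial σ K) :
    freeComponent a j v ∈ freeDegreePart K a j := by
  intro k m hm
  rw [mem_support_iff, coeff_freeComponent] at hm
  by_contra hne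
  exact hm (if_neg hne)

theorem freeComponent_of_mem {a : ι → ℕ} {i : ℕ} {v : ι →₀ MvPolynomial σ K}
    (hv : v ∈ freeDegreePart K a i) (j : ℕ) :
    freeComponent a j v = if i = j then v else 0 := by
  split_ifs with hij
  · subst hij
    exact (mem_freeDegreePart_iff a i v).1 hv
  · ext k m
    rw [coeff_freeComponent]
    split_ifs with hm
    · by_contra hne
      exact hij ((hv k m (mem_support_iff.2 hne)).symm.trans hm)
    · simp

theorem monomial_smul_mem_freeDegreePart {a : ι → ℕ} {j : ℕ} {v : ι →₀ MvPolynomial σ K}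
    (hv : v ∈ freeDegreePart K a j) (m : σ →₀ ℕ) (c : K) :
    monomial m c • v ∈ freeDegreePart K a (Finsupp.degree m + j) := by
  classical
  intro k l hl
  rw [Finsupp.smul_apply, smul_eq_mul, mem_support_iff, coeff_monomial_mul'] at hl
  split_ifs at hl with hml
  · have := hv k (l - m) (mem_support_iff.2 (right_ne_zero_of_mul hl))
    rw [← this, ← add_assoc, ← map_add, add_tsub_cancel_of_le hml]
  · exact absurd rfl hl

/-- A linear map of graded free modules that sends each basis element to a homogeneous element of
the same degree commutes with the projections onto the homogeneous parts. -/
theorem freeComponent_map {a : ι → ℕ} {b : κ → ℕ}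
    {d : (ι →₀ MvPolynomial σ K) →ₗ[MvPolynomial σ K] (κ →₀ MvPolynomial σ K)}
    (hd : ∀ k, d (Finsupp.single k 1) ∈ freeDegreePart K b (a k)) (j : ℕ)
    (v : ι →₀ MvPolynomial σ K) :
    freeComponent b j (d v) = d (freeComponent a j v) := by
  classical
  induction v using Finsupp.induction_linear with
  | zero => simp
  | add v w hv hw => simp only [map_add, hv, hw]
  | single k f =>
    induction f using MvPolynomial.induction_on' with
    | add p q hp hq => simp only [Finsupp.single_add, map_add, hp, hq]
    | monomial m c =>
      have hs : Finsupp.single k (monomial m c) =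
          (monomial m c : MvPolynomial σ K) • Finsupp.single k (1 : MvPolynomial σ K) := by simp
      have h1 : (Finsupp.single k (1 : MvPolynomial σ K)) ∈ freeDegreePart K a (a k) := by
        intro l m hm
        by_cases hkl : k = l
        · subst hkl
          have : m = 0 := by
            by_contra hne
            rw [Finsupp.single_eq_same, mem_support_iff, coeff_one] at hm
            exact hm (if_neg (Ne.symm hne))
          simp [this]
        · simp [hkl] at hm
      rw [hs, map_smul, freeComponent_of_mem (monomial_smul_mem_freeDegreePart (hd k) m c),
        freeComponent_of_mem (monomial_smul_mem_freeDegreePart h1 m c)]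
      split_ifs
      · rw [map_smul]
      · rw [map_zero]

theorem map_mem_freeDegreePart {a : ι → ℕ} {b : κ → ℕ}
    {d : (ι →₀ MvPolynomial σ K) →ₗ[MvPolynomial σ K] (κ →₀ MvPolynomial σ K)}
    (hd : ∀ k, d (Finsupp.single k 1) ∈ freeDegreePart K b (a k)) {j : ℕ}
    {v : ι →₀ MvPolynomial σ K} (hv : v ∈ freeDegreePart K a j) :
    d v ∈ freeDegreePart K b j := by
  rw [mem_freeDegreePart_iff] at hv ⊢
  rw [freeComponent_map hd, hv]

theorem exists_homogeneous_preimage {a : ι → ℕ} {b : κ → ℕ}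
    {d : (ι →₀ MvPolynomial σ K) →ₗ[MvPolynomial σ K] (κ →₀ MvPolynomial σ K)}
    (hd : ∀ k, d (Finsupp.single k 1) ∈ freeDegreePart K b (a k)) {j : ℕ}
    {v : κ →₀ MvPolynomial σ K} (hv : v ∈ freeDegreePart K b j) (hr : v ∈ LinearMap.range d) :
    ∃ w ∈ freeDegreePart K a j, d w = v := by
  obtain ⟨w, rfl⟩ := hr
  refine ⟨freeComponent a j w, freeComponent_mem a j w, ?_⟩
  rw [← freeComponent_map hd, (mem_freeDegreePart_iff b j _).1 hv]

theorem mem_smul_top_iff_apply_mem {R : Type*} [CommRing R] (I : Ideal R) (v : ι →₀ R) :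
    v ∈ I • (⊤ : Submodule R (ι →₀ R)) ↔ ∀ k, v k ∈ I := by
  constructor
  · intro h k
    refine Submodule.smul_induction_on h (fun r hr w _ => ?_) (fun x y hx hy => ?_)
    · exact I.mul_mem_right _ hr
    · exact I.add_mem hx hy
  · intro h
    rw [← Finsupp.sum_single v]
    refine Submodule.sum_mem _ fun k _ => ?_
    have : Finsupp.single k (v k) = v k • Finsupp.single k (1 : R) := by simp
    rw [this]
    exact Submodule.smul_mem_smul (h k) trivial

theorem mem_span_range_X_iff (f : MvPolynomial σ K) :
    f ∈ Ideal.span (Set.range (X : σ → MvPolynomial σ K)) ↔ ∀ m ∈ f.support, m ≠ 0 := by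
  rw [← Set.image_univ, mem_ideal_span_X_image]
  simp [Finsupp.ext_iff]

/-- A homogeneous vector whose degree differs from that of every basis element has its
coordinates in the ideal generated by the variables. -/
theorem mem_smul_top_of_degree_ne {a : ι → ℕ} {j : ℕ} {v : ι →₀ MvPolynomial σ K}
    (hv : v ∈ freeDegreePart K a j) (ha : ∀ k, a k ≠ j) :
    v ∈ Ideal.span (Set.range (X : σ → MvPolynomial σ K)) •
      (⊤ : Submodule (MvPolynomial σ K) (ι →₀ MvPolynomial σ K)) := by
  rw [mem_smul_top_iff_apply_mem]
  intro k
  rw [mem_span_range_X_iff]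
  rintro m hm rfl
  exact ha k (by simpa using hv k 0 hm)

theorem single_one_notMem_smul_top (k : ι) :
    Finsupp.single k 1 ∉ Ideal.span (Set.range (X : σ → MvPolynomial σ K)) •
      (⊤ : Submodule (MvPolynomial σ K) (ι →₀ MvPolynomial σ K)) := by
  classical
  rw [mem_smul_top_iff_apply_mem]
  intro h
  have := (mem_span_range_X_iff _).1 (h k) 0
  simp at this

end Graded

/-! ### Comparison of graded free resolutions -/

section Comparison

theorem map_mem_ideal_smul_top {R M N : Type*} [CommRing R] [AddCommGroup M] [Module R M]
    [AddCommGroup N] [Module R N] (I : Ideal R) (f : M →ₗ[R] N) {x : M}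
    (hx : x ∈ I • (⊤ : Submodule R M)) : f x ∈ I • (⊤ : Submodule R N) := by
  have := Submodule.mem_map_of_mem (f := f) hx
  rw [Submodule.map_smul''] at this
  exact Submodule.smul_mono le_rfl le_top this

theorem exists_linearMap_lift {R ι M N : Type*} [CommRing R] [AddCommGroup M] [Module R M]
    [AddCommGroup N] [Module R N] (f : (ι →₀ R) →ₗ[R] N) (g : M →ₗ[R] N) (P : ι → M → Prop)
    (h : ∀ k, ∃ x, P k x ∧ g x = f (Finsupp.single k 1)) :
    ∃ l : (ι →₀ R) →ₗ[R] M, (∀ k, P k (l (Finsupp.single k 1))) ∧ ∀ x, g (l x) = f x := by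
  choose y hP hy using h
  refine ⟨Finsupp.linearCombination R y, fun k => by simpa using hP k, fun x => ?_⟩
  have : g ∘ₗ Finsupp.linearCombination R y = f := by
    ext k
    simp [hy]
  exact LinearMap.congr_fun this x

/-- One step of the comparison of a minimal resolution `P` with a resolution `Q`: given maps `α₀`,
`β₀` between the modules in one homological degree and a homotopy `h₀` between `β₀ α₀` and the
identity, it produces maps `α`, `β`, `h` in the next degree, with `α` homogeneous and with `β α`
congruent to the identity modulo the ideal `𝔪` generated by the variables. The relation between
`h₀`, `α₀`, `β₀` is recorded on boundaries only, so that it does not mention the homotopy in the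
degree below. -/
theorem comparison_step {K σ ι κ P₀ Q₀ P₂ Q₂ : Type*} [Field K]
    [AddCommGroup P₀] [Module (MvPolynomial σ K) P₀] [AddCommGroup Q₀] [Module (MvPolynomial σ K) Q₀]
    [AddCommGroup P₂] [Module (MvPolynomial σ K) P₂] [AddCommGroup Q₂] [Module (MvPolynomial σ K) Q₂]
    [Module.Projective (MvPolynomial σ K) P₂]
    (a : ι → ℕ) (b : κ → ℕ)
    (d : (ι →₀ MvPolynomial σ K) →ₗ[MvPolynomial σ K] P₀)
    (d' : (κ →₀ MvPolynomial σ K) →ₗ[MvPolynomial σ K] Q₀)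
    (e : P₂ →ₗ[MvPolynomial σ K] (ι →₀ MvPolynomial σ K))
    (e' : Q₂ →ₗ[MvPolynomial σ K] (κ →₀ MvPolynomial σ K))
    (hed : Function.Exact e d) (hed' : Function.Exact e' d')
    (he : LinearMap.range e ≤ Ideal.span (Set.range (X : σ → MvPolynomial σ K)) •
      (⊤ : Submodule (MvPolynomial σ K) (ι →₀ MvPolynomial σ K)))
    (α₀ : P₀ →ₗ[MvPolynomial σ K] Q₀) (β₀ : Q₀ →ₗ[MvPolynomial σ K] P₀)
    (h₀ : P₀ →ₗ[MvPolynomial σ K] (ι →₀ MvPolynomial σ K))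
    (hα : ∀ k, ∃ v ∈ freeDegreePart K b (a k), d' v = α₀ (d (Finsupp.single k 1)))
    (hβ : ∀ y, β₀ (d' y) ∈ LinearMap.range d)
    (hh : ∀ x, d (h₀ (d x)) = β₀ (α₀ (d x)) - d x)
    (hm : ∀ x, h₀ (d x) ∈ Ideal.span (Set.range (X : σ → MvPolynomial σ K)) •
      (⊤ : Submodule (MvPolynomial σ K) (ι →₀ MvPolynomial σ K))) :
    ∃ (α : (ι →₀ MvPolynomial σ K) →ₗ[MvPolynomial σ K] (κ →₀ MvPolynomial σ K))
      (β : (κ →₀ MvPolynomial σ K) →ₗ[MvPolynomial σ K] (ι →₀ MvPolynomial σ K))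
      (h : (ι →₀ MvPolynomial σ K) →ₗ[MvPolynomial σ K] P₂),
      (∀ k, α (Finsupp.single k 1) ∈ freeDegreePart K b (a k)) ∧
      (∀ x, α (e x) ∈ LinearMap.range e') ∧
      (∀ y, β (e' y) ∈ LinearMap.range e) ∧
      (∀ x, e (h (e x)) = β (α (e x)) - e x) ∧
      ∀ x, β (α x) - x ∈ Ideal.span (Set.range (X : σ → MvPolynomial σ K)) •
        (⊤ : Submodule (MvPolynomial σ K) (ι →₀ MvPolynomial σ K)) := by
  obtain ⟨α, hαg, hαd⟩ := exists_linearMap_lift (α₀ ∘ₗ d) d' (fun k v => v ∈ freeDegreePart K b (a k))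
    (by simpa using hα)
  obtain ⟨β, -, hβd⟩ := exists_linearMap_lift (β₀ ∘ₗ d') d (fun _ _ => True) (by
    intro k
    obtain ⟨x, hx⟩ := hβ (Finsupp.single k 1)
    exact ⟨x, trivial, hx⟩)
  simp only [LinearMap.comp_apply] at hαd hβd
  have hker : ∀ x, d (β (α x) - x - h₀ (d x)) = 0 := by
    intro x
    rw [map_sub, map_sub, hβd, hαd, hh, sub_self]
  obtain ⟨h, -, hhe⟩ := exists_linearMap_lift (β ∘ₗ α - LinearMap.id - h₀ ∘ₗ d) e
    (fun _ _ => True) (by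
      intro k
      obtain ⟨x, hx⟩ := (hed _).1 (hker (Finsupp.single k 1))
      exact ⟨x, trivial, by simpa using hx⟩)
  simp only [LinearMap.sub_apply, LinearMap.comp_apply, LinearMap.id_apply] at hhe
  refine ⟨α, β, h, hαg, fun x => ?_, fun y => ?_, fun x => ?_, fun x => ?_⟩
  · refine (hed' _).1 ?_
    rw [hαd, hed.apply_apply_eq_zero, map_zero]
  · refine (hed _).1 ?_
    rw [hβd, hed'.apply_apply_eq_zero, map_zero]
  · rw [hhe, hed.apply_apply_eq_zero, map_zero, sub_zero]
  · have : β (α x) - x = e (h x) + h₀ (d x) := by rw [hhe]; abel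
    rw [this]
    exact Submodule.add_mem _ (he ⟨_, rfl⟩) (hm x)

/-- The degrees of the basis of a minimal graded free resolution occur, in the same homological
degree, in every graded free resolution `G` of the same module. The augmentation of `G` is asked to
be surjective in each degree. -/
theorem GradedFreeResolution.IsMinimal.exists_shift_eq {K σ M : Type*} [Field K] [AddCommGroup M]
    [Module K M] [Module (MvPolynomial σ K) M] {𝓜 : ℕ → Submodule K M}
    {F : GradedFreeResolution (σ := σ) 𝓜} (hF : F.IsMinimal) (G : GradedFreeResolution (σ := σ) 𝓜)
    (hG : ∀ j, ∀ m ∈ 𝓜 j, ∃ v ∈ freeDegreePart K (G.shift 0) j, G.aug v = m)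
    (i : ℕ) (k : F.idx i) : ∃ l : G.idx i, G.shift i l = F.shift i k := by
  have key : ∃ (α : (F.idx i →₀ MvPolynomial σ K) →ₗ[MvPolynomial σ K]
        (G.idx i →₀ MvPolynomial σ K))
      (β : (G.idx i →₀ MvPolynomial σ K) →ₗ[MvPolynomial σ K] (F.idx i →₀ MvPolynomial σ K))
      (h : (F.idx i →₀ MvPolynomial σ K) →ₗ[MvPolynomial σ K]
        (F.idx (i + 1) →₀ MvPolynomial σ K)),
      (∀ k, α (Finsupp.single k 1) ∈ freeDegreePart K (G.shift i) (F.shift i k)) ∧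
      (∀ x, α (F.d i x) ∈ LinearMap.range (G.d i)) ∧
      (∀ y, β (G.d i y) ∈ LinearMap.range (F.d i)) ∧
      (∀ x, F.d i (h (F.d i x)) = β (α (F.d i x)) - F.d i x) ∧
      ∀ x, β (α x) - x ∈ Ideal.span (Set.range (X : σ → MvPolynomial σ K)) •
        (⊤ : Submodule (MvPolynomial σ K) (F.idx i →₀ MvPolynomial σ K)) := by
    clear k
    induction i with
    | zero =>
      refine comparison_step (F.shift 0) (G.shift 0) F.aug G.aug (F.d 0) (G.d 0) F.exact_aug
        G.exact_aug (hF 0) LinearMap.id LinearMap.id 0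
        (fun k => hG _ _ (F.aug_homogeneous k)) (fun y => F.aug_surjective _) ?_ ?_ <;> simp
    | succ i ih =>
      obtain ⟨α, β, h, hα, hαr, hβr, hh, -⟩ := ih
      exact comparison_step (F.shift (i + 1)) (G.shift (i + 1)) (F.d i) (G.d i) (F.d (i + 1))
        (G.d (i + 1)) (F.exact_d i) (G.exact_d i) (hF (i + 1)) α β h
        (fun k => exists_homogeneous_preimage (G.d_homogeneous i)
          (map_mem_freeDegreePart hα (F.d_homogeneous i k)) (hαr _))
        hβr hh (fun x => map_mem_ideal_smul_top _ h (hF i ⟨x, rfl⟩))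
  obtain ⟨α, β, -, hα, -, -, -, hβα⟩ := key
  by_contra! hne
  refine single_one_notMem_smul_top (K := K) (σ := σ) k ?_
  have h1 := map_mem_ideal_smul_top _ β (mem_smul_top_of_degree_ne (hα k) hne)
  simpa using Submodule.sub_mem _ h1 (hβα (Finsupp.single k 1))

end Comparison

/-! ### Linear quotients and syzygies -/

section LeadIdeal

variable {R ι : Type*} [CommRing R]

/-- The ideal of leading coefficients at `i` of a submodule `N` of the free module with ordered
basis `ι`: the coordinates at `i` of those elements of `N` whose coordinates beyond `i` vanish. If
`N` is the kernel of `e_i ↦ g_i`, this is the colon ideal `(g_j : j < i) : g_i`. -/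
noncomputable def leadIdeal [Preorder ι] (N : Submodule R (ι →₀ R)) (i : ι) : Ideal R :=
  Submodule.map (Finsupp.lapply i) (N ⊓ Finsupp.supported R R (Set.Iic i))

theorem mem_leadIdeal [Preorder ι] {N : Submodule R (ι →₀ R)} {i : ι} {f : R} :
    f ∈ leadIdeal N i ↔ ∃ v ∈ N, v ∈ Finsupp.supported R R (Set.Iic i) ∧ v i = f := by
  simp [leadIdeal, Submodule.mem_map, and_assoc]

theorem exists_lt_mem_supported_Iic [LinearOrder ι] {i : ι} {v : ι →₀ R}
    (hv : v ∈ Finsupp.supported R R (Set.Iio i)) (h0 : v ≠ 0) :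
    ∃ j < i, v ∈ Finsupp.supported R R (Set.Iic j) := by
  have hne : v.support.Nonempty := Finsupp.support_nonempty_iff.2 h0
  refine ⟨v.support.max' hne, hv (v.support.max'_mem hne), fun l hl => ?_⟩
  exact v.support.le_max' l hl

theorem mem_supported_Iio [LinearOrder ι] {i : ι} {v : ι →₀ R}
    (hv : v ∈ Finsupp.supported R R (Set.Iic i)) (hi : v i = 0) :
    v ∈ Finsupp.supported R R (Set.Iio i) := by
  rw [Finsupp.mem_supported'] at hv ⊢
  intro j hj
  rcases eq_or_ne j i with rfl | hne
  · exact hi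
  · exact hv j fun h => hj (lt_of_le_of_ne h hne)

end LeadIdeal

section Syzygies

variable {K σ ι : Type*} [Field K]

theorem mem_span_X_image_of_mul_X_mem {T : Set σ} {x : σ} (hx : x ∉ T) {f : MvPolynomial σ K}
    (hf : f * X x ∈ Ideal.span (X '' T : Set (MvPolynomial σ K))) :
    f ∈ Ideal.span (X '' T : Set (MvPolynomial σ K)) := by
  classical
  rw [mem_ideal_span_X_image] at hf ⊢
  intro m hm
  obtain ⟨y, hyT, hy⟩ := hf (m + Finsupp.single x 1) (by
    rw [mem_support_iff, coeff_mul_X]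
    exact mem_support_iff.1 hm)
  refine ⟨y, hyT, fun h => hy ?_⟩
  have : x ≠ y := fun h => hx (h ▸ hyT)
  simp [h, this]

variable [LinearOrder ι]

/-- The index set of the first syzygies of a module whose colon ideals are generated by the
variables in the sets `S i`: the pairs `(i, x)` with `x ∈ S i`, ordered lexicographically. -/
abbrev SyzygyIndex (S : ι → Set σ) : Type _ :=
  {p : ι ×ₗ σ // (ofLex p).2 ∈ S (ofLex p).1}

/-- The data of syzygies `r (i, x) = x e_i + (terms below i)` in `N`, whose leading terms generate
the leading ideals of `N`. -/
structure IsLeadingBasis (N : Submodule (MvPolynomial σ K) (ι →₀ MvPolynomial σ K))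
    (S : ι → Set σ) (r : SyzygyIndex S → (ι →₀ MvPolynomial σ K)) : Prop where
  lead : ∀ i, leadIdeal N i = Ideal.span (X '' S i)
  mem : ∀ p, r p ∈ N
  supported : ∀ p, r p ∈ Finsupp.supported (MvPolynomial σ K) (MvPolynomial σ K) (Set.Iic (ofLex p.1).1)
  apply_self : ∀ p, r p (ofLex p.1).1 = X (ofLex p.1).2

variable {N : Submodule (MvPolynomial σ K) (ι →₀ MvPolynomial σ K)} {S : ι → Set σ}
  {r : SyzygyIndex S → (ι →₀ MvPolynomial σ K)}

theorem IsLeadingBasis.linearCombination_mem (hr : IsLeadingBasis N S r)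
    (w : SyzygyIndex S →₀ MvPolynomial σ K) :
    Finsupp.linearCombination (MvPolynomial σ K) r w ∈ N :=
  Submodule.sum_mem _ fun p _ => N.smul_mem _ (hr.mem p)

theorem IsLeadingBasis.linearCombination_mem_supported (hr : IsLeadingBasis N S r) {i : ι}
    {w : SyzygyIndex S →₀ MvPolynomial σ K}
    (hw : w ∈ Finsupp.supported (MvPolynomial σ K) (MvPolynomial σ K)
      {p : SyzygyIndex S | (ofLex p.1).1 ≤ i}) :
    Finsupp.linearCombination (MvPolynomial σ K) r w ∈
      Finsupp.supported (MvPolynomial σ K) (MvPolynomial σ K) (Set.Iic i) :=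
  Submodule.sum_mem _ fun p hp => Submodule.smul_mem _ _ <|
    Finsupp.supported_mono (Set.Iic_subset_Iic.2 (hw hp)) (hr.supported p)

variable [Finite ι]

/-- Division with respect to the leading terms: the elements of `N` are combinations of the
syzygies `r`, and only the syzygies that are not beyond the leading position are needed. -/
theorem IsLeadingBasis.exists_linearCombination_eq (hr : IsLeadingBasis N S r) (i : ι) :
    ∀ v ∈ N, v ∈ Finsupp.supported (MvPolynomial σ K) (MvPolynomial σ K) (Set.Iic i) →
      ∃ w ∈ Finsupp.supported (MvPolynomial σ K) (MvPolynomial σ K)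
        {p : SyzygyIndex S | (ofLex p.1).1 ≤ i},
        Finsupp.linearCombination (MvPolynomial σ K) r w = v := by
  induction i using WellFoundedLT.induction with
  | ind i ih =>
  intro v hv hvi
  -- The leading coefficient of `v` is matched first.
  have hlead : Ideal.span (X '' S i : Set (MvPolynomial σ K)) ≤
      Submodule.map (Finsupp.lapply i ∘ₗ Finsupp.linearCombination (MvPolynomial σ K) r)
        (Finsupp.supported (MvPolynomial σ K) (MvPolynomial σ K)
          {p : SyzygyIndex S | (ofLex p.1).1 ≤ i}) := by
    refine Submodule.span_le.2 ?_
    rintro _ ⟨x, hx, rfl⟩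
    refine ⟨Finsupp.single ⟨toLex (i, x), hx⟩ 1, Finsupp.single_mem_supported _ _ ?_, ?_⟩
    · exact le_refl i
    · simpa using hr.apply_self ⟨toLex (i, x), hx⟩
  have hmem : v i ∈ leadIdeal N i := mem_leadIdeal.2 ⟨v, hv, hvi, rfl⟩
  rw [hr.lead] at hmem
  obtain ⟨w, hw, hwv⟩ := hlead hmem
  have hwv' : Finsupp.linearCombination (MvPolynomial σ K) r w i = v i := hwv
  have hu : v - Finsupp.linearCombination (MvPolynomial σ K) r w ∈
      Finsupp.supported (MvPolynomial σ K) (MvPolynomial σ K) (Set.Iio i) :=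
    mem_supported_Iio (Submodule.sub_mem _ hvi (hr.linearCombination_mem_supported hw))
      (by rw [Finsupp.sub_apply, hwv', sub_self])
  by_cases h0 : v - Finsupp.linearCombination (MvPolynomial σ K) r w = 0
  · exact ⟨w, hw, (sub_eq_zero.1 h0).symm⟩
  · obtain ⟨j, hj, hsj⟩ := exists_lt_mem_supported_Iic hu h0
    obtain ⟨w', hw', he⟩ := ih j hj _ (N.sub_mem hv (hr.linearCombination_mem w)) hsj
    refine ⟨w + w', Submodule.add_mem _ hw (Finsupp.supported_mono ?_ hw'), ?_⟩
    · exact fun p hp => le_trans hp hj.le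
    · rw [map_add, he, add_sub_cancel]

theorem IsLeadingBasis.exists_linearCombination_eq_of_lt (hr : IsLeadingBasis N S r) {i : ι}
    {v : ι →₀ MvPolynomial σ K} (hv : v ∈ N)
    (hvi : v ∈ Finsupp.supported (MvPolynomial σ K) (MvPolynomial σ K) (Set.Iio i)) :
    ∃ w ∈ Finsupp.supported (MvPolynomial σ K) (MvPolynomial σ K)
        {p : SyzygyIndex S | (ofLex p.1).1 < i},
        Finsupp.linearCombination (MvPolynomial σ K) r w = v := by
  by_cases h0 : v = 0
  · exact ⟨0, Submodule.zero_mem _, by simp [h0]⟩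
  · obtain ⟨j, hj, hsj⟩ := exists_lt_mem_supported_Iic hvi h0
    obtain ⟨w, hw, he⟩ := hr.exists_linearCombination_eq j v hv hsj
    exact ⟨w, Finsupp.supported_mono (fun p hp => lt_of_le_of_lt hp hj) hw, he⟩

theorem IsLeadingBasis.range_linearCombination (hr : IsLeadingBasis N S r) :
    LinearMap.range (Finsupp.linearCombination (MvPolynomial σ K) r) = N := by
  refine le_antisymm ?_ fun v hv => ?_
  · rintro _ ⟨w, rfl⟩
    exact hr.linearCombination_mem w
  · by_cases h0 : v = 0
    · exact h0 ▸ Submodule.zero_mem _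
    · have hne : v.support.Nonempty := Finsupp.support_nonempty_iff.2 h0
      obtain ⟨w, -, he⟩ := hr.exists_linearCombination_eq (v.support.max' hne) v hv
        (fun l hl => v.support.le_max' l hl)
      exact ⟨w, he⟩

variable [LinearOrder σ]

/-- Linear quotients pass to syzygies: the leading ideal of the relations among the `r p` at
`(i, x)` is generated by the variables of `S i` that precede `x`. -/
theorem IsLeadingBasis.leadIdeal_ker (hr : IsLeadingBasis N S r) (p : SyzygyIndex S) :
    leadIdeal (LinearMap.ker (Finsupp.linearCombination (MvPolynomial σ K) r)) p =
      Ideal.span (X '' {y | y ∈ S (ofLex p.1).1 ∧ y < (ofLex p.1).2}) := by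
  classical
  obtain ⟨⟨i, x⟩, hx⟩ := p
  change x ∈ S i at hx
  set p : SyzygyIndex S := ⟨toLex (i, x), hx⟩ with hp
  change leadIdeal _ p = Ideal.span (X '' {y | y ∈ S i ∧ y < x} : Set (MvPolynomial σ K))
  apply le_antisymm
  · intro f hf
    obtain ⟨w, hw, hws, rfl⟩ := mem_leadIdeal.1 hf
    refine mem_span_X_image_of_mul_X_mem (x := x) (fun h => lt_irrefl _ h.2) ?_
    -- The coordinate at `i` of the relation `w` expresses `w p * X x` through smaller variables.
    have hcoord : ∑ q ∈ w.support, w q * r q i = 0 := by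
      have := DFunLike.congr_fun (LinearMap.mem_ker.1 hw) i
      rw [Finsupp.linearCombination_apply, Finsupp.sum, Finsupp.finsetSum_apply] at this
      simpa using this
    have hrp : r p i = X x := hr.apply_self p
    have hsum : w p * X x = -∑ q ∈ w.support.erase p, w q * r q i := by
      rw [eq_neg_iff_add_eq_zero, ← hcoord, ← hrp]
      by_cases hpw : p ∈ w.support
      · rw [Finset.add_sum_erase _ (fun q => w q * r q i) hpw]
      · rw [Finsupp.notMem_support_iff.1 hpw, zero_mul, zero_add, Finset.erase_eq_of_notMem hpw]
    rw [hsum]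
    refine neg_mem (Submodule.sum_mem _ fun q hq => Ideal.mul_mem_left _ _ ?_)
    have hqp : q.1 ≤ p.1 := hws (Finset.mem_of_mem_erase hq)
    have hqne : q.1 ≠ p.1 := fun h => Finset.ne_of_mem_erase hq (Subtype.ext h)
    have hlt : q.1 < p.1 := lt_of_le_of_ne hqp hqne
    rcases Prod.Lex.lt_iff.1 hlt with h | ⟨h1, h2⟩
    · rw [(Finsupp.mem_supported' _ _).1 (hr.supported q) i (not_le.2 h)]
      exact zero_mem _
    · have h1' : (ofLex q.1).1 = i := h1
      rw [← h1', hr.apply_self q]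
      exact Ideal.subset_span ⟨_, ⟨q.2, h2⟩, rfl⟩
  · refine Ideal.span_le.2 ?_
    rintro _ ⟨y, ⟨hy, hyx⟩, rfl⟩
    set q : SyzygyIndex S := ⟨toLex (i, y), hy⟩ with hq
    have hqp : q < p := Prod.Lex.lt_iff.2 (Or.inr ⟨rfl, hyx⟩)
    have hrp : r p i = X x := hr.apply_self p
    have hrq : r q i = X y := hr.apply_self q
    -- The Koszul relation between `r p` and `r q`, up to terms below `i`.
    set w₀ : SyzygyIndex S →₀ MvPolynomial σ K :=
      Finsupp.single p (X y) - Finsupp.single q (X x) with hw₀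
    have hw₀s : w₀ ∈ Finsupp.supported (MvPolynomial σ K) (MvPolynomial σ K)
        {p : SyzygyIndex S | (ofLex p.1).1 ≤ i} :=
      Submodule.sub_mem _ (Finsupp.single_mem_supported _ _ (le_refl i))
        (Finsupp.single_mem_supported _ _ (le_refl i))
    have h0 : Finsupp.linearCombination (MvPolynomial σ K) r w₀ i = 0 := by
      simp [hw₀, hrp, hrq, mul_comm]
    obtain ⟨w₁, hw₁, he⟩ := hr.exists_linearCombination_eq_of_lt (hr.linearCombination_mem w₀)
      (mem_supported_Iio (hr.linearCombination_mem_supported hw₀s) h0)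
    have hw₁p : ∀ l : SyzygyIndex S, p ≤ l → w₁ l = 0 := by
      intro l hl
      refine (Finsupp.mem_supported' _ _).1 hw₁ l fun h => ?_
      exact absurd (Prod.Lex.lt_iff.2 (Or.inl h) : l.1 < p.1) (not_lt.2 hl)
    refine mem_leadIdeal.2 ⟨w₀ - w₁, ?_, ?_, ?_⟩
    · rw [LinearMap.mem_ker, map_sub, he, sub_self]
    · rw [Finsupp.mem_supported']
      intro l hl
      have hl' : p < l := not_le.1 hl
      rw [Finsupp.sub_apply, hw₁p l hl'.le, hw₀, Finsupp.sub_apply,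
        Finsupp.single_eq_of_ne hl'.ne', Finsupp.single_eq_of_ne (hqp.trans hl').ne', sub_zero,
        sub_zero]
    · rw [Finsupp.sub_apply, hw₁p p le_rfl, hw₀, Finsupp.sub_apply, Finsupp.single_eq_same,
        Finsupp.single_eq_of_ne hqp.ne', sub_zero, sub_zero]

end Syzygies

/-! ### The linear resolution -/

/-- A map `φ : R(-deg)^gen → R(-targetDeg)^target` of graded free modules that is a stage of a
linear resolution: it is homogeneous of degree zero, its matrix has entries of positive degree, and
the images of the basis elements have linear quotients, with colon ideals generated by variables. -/
structure LinearStage (K : Type*) (σ : Type) [Field K] where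
  target : Type
  finite_target : Finite target
  targetDeg : ℕ
  gen : Type
  finite_gen : Finite gen
  order : LinearOrder gen
  deg : ℕ
  targetDeg_lt : targetDeg < deg
  φ : (gen →₀ MvPolynomial σ K) →ₗ[MvPolynomial σ K] (target →₀ MvPolynomial σ K)
  homogeneous : ∀ i, φ (Finsupp.single i 1) ∈ freeDegreePart K (fun _ => targetDeg) deg
  colon : gen → Set σ
  lead : ∀ i, leadIdeal (LinearMap.ker φ) i = Ideal.span (X '' colon i)

attribute [instance] LinearStage.order LinearStage.finite_gen LinearStage.finite_target

namespace LinearStage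

variable {K : Type*} {σ : Type} [Field K]

theorem range_φ_le (s : LinearStage K σ) :
    LinearMap.range s.φ ≤ Ideal.span (Set.range (X : σ → MvPolynomial σ K)) •
      (⊤ : Submodule (MvPolynomial σ K) (s.target →₀ MvPolynomial σ K)) := by
  rintro _ ⟨v, rfl⟩
  rw [← Finsupp.sum_single v, Finsupp.sum, map_sum]
  refine Submodule.sum_mem _ fun k _ => ?_
  have : Finsupp.single k (v k) = v k • Finsupp.single k (1 : MvPolynomial σ K) := by simp
  rw [this, map_smul]
  exact Submodule.smul_mem _ _
    (mem_smul_top_of_degree_ne (s.homogeneous k) fun _ => s.targetDeg_lt.ne)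

variable [LinearOrder σ]

theorem exists_isLeadingBasis (s : LinearStage K σ) :
    ∃ r : SyzygyIndex s.colon → (s.gen →₀ MvPolynomial σ K),
      IsLeadingBasis (LinearMap.ker s.φ) s.colon r ∧
        ∀ p, r p ∈ freeDegreePart K (fun _ => s.deg) (s.deg + 1) := by
  have h : ∀ p : SyzygyIndex s.colon, ∃ v : s.gen →₀ MvPolynomial σ K,
      v ∈ LinearMap.ker s.φ ∧
      v ∈ Finsupp.supported (MvPolynomial σ K) (MvPolynomial σ K) (Set.Iic (ofLex p.1).1) ∧
      v (ofLex p.1).1 = X (ofLex p.1).2 ∧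
      v ∈ freeDegreePart K (fun _ => s.deg) (s.deg + 1) := by
    intro p
    have hX : (X (ofLex p.1).2 : MvPolynomial σ K) ∈
        leadIdeal (LinearMap.ker s.φ) (ofLex p.1).1 := by
      rw [s.lead]
      exact Ideal.subset_span ⟨_, p.2, rfl⟩
    obtain ⟨v, hv, hvs, hvX⟩ := mem_leadIdeal.1 hX
    refine ⟨freeComponent (fun _ => s.deg) (s.deg + 1) v, ?_, ?_, ?_, freeComponent_mem _ _ v⟩
    · rw [LinearMap.mem_ker, ← freeComponent_map (a := fun _ => s.deg) s.homogeneous,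
        LinearMap.mem_ker.1 hv, map_zero]
    · rw [Finsupp.mem_supported'] at hvs ⊢
      intro j hj
      ext m
      rw [coeff_freeComponent, hvs j hj]
      simp
    · ext m
      rw [coeff_freeComponent, hvX]
      split_ifs with hm
      · rfl
      · classical
        rw [coeff_X]
        split_ifs with h'
        · refine absurd ?_ hm
          rw [← h']
          simp [add_comm]
        · rfl
  choose r h1 h2 h3 h4 using h
  exact ⟨r, ⟨s.lead, h1, h2, h3⟩, h4⟩

variable [Finite σ]

/-- The next stage of the linear resolution: the syzygies of `φ` given by leading terms. -/
noncomputable def next (s : LinearStage K σ) : LinearStage K σ where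
  target := s.gen
  finite_target := s.finite_gen
  targetDeg := s.deg
  gen := SyzygyIndex s.colon
  finite_gen := by
    have : Finite (s.gen ×ₗ σ) := inferInstanceAs (Finite (s.gen × σ))
    infer_instance
  order := inferInstance
  deg := s.deg + 1
  targetDeg_lt := Nat.lt_succ_self _
  φ := Finsupp.linearCombination (MvPolynomial σ K) s.exists_isLeadingBasis.choose
  homogeneous := fun p => by
    rw [Finsupp.linearCombination_single, one_smul]
    exact s.exists_isLeadingBasis.choose_spec.2 p
  colon := fun p => {y | y ∈ s.colon (ofLex p.1).1 ∧ y < (ofLex p.1).2}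
  lead := s.exists_isLeadingBasis.choose_spec.1.leadIdeal_ker

theorem exact_next (s : LinearStage K σ) : Function.Exact s.next.φ s.φ :=
  LinearMap.exact_iff.2 s.exists_isLeadingBasis.choose_spec.1.range_linearCombination.symm

/-- The sequence of stages that starts with `s`. -/
noncomputable def iter (s : LinearStage K σ) : ℕ → LinearStage K σ
  | 0 => s
  | i + 1 => (iter s i).next

theorem deg_iter (s : LinearStage K σ) (i : ℕ) : (s.iter i).deg = s.deg + i := by
  induction i with
  | zero => rfl
  | succ i ih => exact (congrArg (· + 1) ih).trans (add_assoc _ _ _)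

/-- The resolution of the cokernel of the first stage. -/
noncomputable def resolution (s : LinearStage K σ) {M : Type*} [AddCommGroup M] [Module K M]
    [Module (MvPolynomial σ K) M] {𝓜 : ℕ → Submodule K M}
    (aug : (s.target →₀ MvPolynomial σ K) →ₗ[MvPolynomial σ K] M)
    (hom : ∀ k, aug (Finsupp.single k 1) ∈ 𝓜 s.targetDeg) (surj : Function.Surjective aug)
    (exact_aug : Function.Exact s.φ aug) : GradedFreeResolution (σ := σ) 𝓜 where
  idx i := (s.iter i).target
  finite_idx i := (s.iter i).finite_target
  shift i _ := (s.iter i).targetDeg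
  d i := (s.iter i).φ
  aug := aug
  d_homogeneous i := (s.iter i).homogeneous
  aug_homogeneous := hom
  aug_surjective := surj
  exact_aug := exact_aug
  exact_d i := (s.iter i).exact_next

end LinearStage

/-! ### Powers of the path ideal of a short path graph -/

section Generators

variable {k : ℕ}

/-- The monotone sequences `C : Fin k → {0, …, s}`. They index the minimal generators of the `s`-th
power of `I_t(L_{t+k})` for `k ≤ t`, see `pathExponent`. -/
abbrev BoundedMonotone (k s : ℕ) : Type :=
  {C : Fin k → ℕ // Monotone C ∧ ∀ j, C j ≤ s}

instance (k s : ℕ) : Finite (BoundedMonotone k s) :=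
  Finite.Set.subset (Set.Iic fun _ : Fin k => s) fun _ h => h.2

/-- The exponent of the generator indexed by `C` of the `s`-th power of `I_t(L_{t+k})`. Numbering
the vertices from zero, a path on `t` vertices contains all of the vertices `k, …, t - 1`, and it
contains exactly one of the vertices `j` and `t + j` for `j < k`. If `s` paths are given, then
`C j` is the number of those that contain `j`. -/
noncomputable def pathExponent (t s : ℕ) (C : Fin k → ℕ) : Fin (t + k) →₀ ℕ :=
  Finsupp.equivFunOnFinite.symm fun p =>
    if h : p.val < k then C ⟨p, h⟩
    else if h' : p.val < t then s else s - C ⟨p - t, by omega⟩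

theorem pathExponent_apply (t s : ℕ) (C : Fin k → ℕ) (p : Fin (t + k)) :
    pathExponent t s C p = if h : p.val < k then C ⟨p, h⟩
      else if h' : p.val < t then s else s - C ⟨p - t, by omega⟩ := rfl

theorem pathExponent_natAdd {t : ℕ} (hkt : k ≤ t) (s : ℕ) (C : Fin k → ℕ) (j : Fin k) :
    pathExponent t s C (Fin.natAdd t j) = s - C j := by
  have h1 : ¬ (t + j.val < k) := by omega
  simp [pathExponent_apply, h1]

theorem pathExponent_add {t s s' : ℕ} {C C' : Fin k → ℕ} (hC : ∀ j, C j ≤ s)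
    (hC' : ∀ j, C' j ≤ s') :
    pathExponent t (s + s') (C + C') = pathExponent t s C + pathExponent t s' C' := by
  ext p
  simp only [pathExponent_apply, Finsupp.add_apply, Pi.add_apply]
  split_ifs with h h'
  · rfl
  · rfl
  · have := hC ⟨p - t, by omega⟩
    have := hC' ⟨p - t, by omega⟩
    omega

/-- The ideal generated by the monomials with exponents `pathExponent t s C`. -/
noncomputable def monotoneIdeal (K : Type*) [Field K] (k t s : ℕ) :
    Ideal (MvPolynomial (Fin (t + k)) K) :=
  Ideal.span (Set.range fun C : BoundedMonotone k s => monomial (pathExponent t s C.1) (1 : K))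

theorem monotoneIdeal_succ (K : Type*) [Field K] (k t s : ℕ) :
    monotoneIdeal K k t (s + 1) = monotoneIdeal K k t s * monotoneIdeal K k t 1 := by
  rw [monotoneIdeal, monotoneIdeal, monotoneIdeal, Ideal.span_mul_span']
  congr 1
  ext f
  simp only [Set.mem_mul, Set.mem_range, exists_exists_eq_and]
  constructor
  · rintro ⟨⟨C, hC, hCs⟩, rfl⟩
    refine ⟨⟨fun j => C j - 1, fun i j hij => Nat.sub_le_sub_right (hC hij) 1,
      fun j => Nat.sub_le_of_le_add (hCs j)⟩, ⟨fun j => min (C j) 1, fun i j hij => min_le_min_right 1 (hC hij),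
      fun j => min_le_right _ _⟩, ?_⟩
    rw [monomial_mul, mul_one, ← pathExponent_add]
    · congr 3
      funext j
      simp only [Pi.add_apply]
      omega
    · exact fun j => Nat.sub_le_of_le_add (hCs j)
    · exact fun j => min_le_right _ _
  · rintro ⟨C, C', rfl⟩
    refine ⟨⟨C.1 + C'.1, C.2.1.add C'.2.1, fun j => add_le_add (C.2.2 j) (C'.2.2 j)⟩, ?_⟩
    rw [monomial_mul, mul_one, ← pathExponent_add C.2.2 C'.2.2]

theorem monotoneIdeal_eq_pow (K : Type*) [Field K] (k t s : ℕ) :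
    monotoneIdeal K k t s = monotoneIdeal K k t 1 ^ s := by
  induction s with
  | zero =>
    rw [pow_zero, Ideal.one_eq_top, Ideal.eq_top_iff_one]
    refine Ideal.subset_span ⟨⟨fun _ => 0, monotone_const, fun _ => le_rfl⟩, ?_⟩
    have : pathExponent t 0 (fun _ : Fin k => 0) = 0 := by
      ext p
      simp [pathExponent_apply]
    simp [this]
  | succ s ih => rw [monotoneIdeal_succ, ih, pow_succ]

theorem degree_pathExponent {t : ℕ} (hkt : k ≤ t) {s : ℕ} {C : Fin k → ℕ} (hC : ∀ j, C j ≤ s) :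
    Finsupp.degree (pathExponent t s C) = t * s := by
  obtain ⟨e, rfl⟩ := Nat.exists_eq_add_of_le hkt
  rw [Finsupp.degree_eq_sum, Fin.sum_univ_add, Fin.sum_univ_add]
  have h1 : ∀ j : Fin k, pathExponent (k + e) s C (Fin.castAdd k (Fin.castAdd e j)) = C j := by
    intro j; simp [pathExponent_apply]
  have h2 : ∀ j : Fin e, pathExponent (k + e) s C (Fin.castAdd k (Fin.natAdd k j)) = s := by
    intro j; simp [pathExponent_apply]
  simp only [h1, h2, pathExponent_natAdd hkt]
  have h3 : ∑ j, C j + ∑ j, (s - C j) = k * s := by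
    rw [← Finset.sum_add_distrib, Finset.sum_congr rfl fun j _ => Nat.add_sub_of_le (hC j)]
    simp
  rw [add_right_comm, h3]
  simp [add_mul]

/-- The exchange property behind the linear quotients: if `C' j < C j`, then `C` can be lowered by
one at the first place `i` where it takes the value `C j`, and `C' i < C i`. -/
theorem exists_monotone_update {C C' : Fin k → ℕ} (hC : Monotone C) (hC' : Monotone C')
    {j : Fin k} (hj : C' j < C j) :
    ∃ i, C' i < C i ∧ Monotone (Function.update C i (C i - 1)) := by
  obtain ⟨i, hi, hmin⟩ := WellFounded.has_min (wellFounded_lt (α := Fin k)) {i | C i = C j} ⟨j, rfl⟩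
  have hij : i ≤ j := not_lt.1 (hmin j rfl)
  refine ⟨i, ?_, ?_⟩
  · have h1 : C i = C j := hi
    have h2 := hC' hij
    omega
  · intro a b hab
    rcases eq_or_ne b i with rfl | hb
    · rcases eq_or_ne a b with rfl | ha
      · exact le_rfl
      · have h1 : C a ≠ C b := fun h => hmin a (h.trans hi) (lt_of_le_of_ne hab ha)
        have h2 := hC hab
        rw [Function.update_self, Function.update_of_ne ha]
        omega
    · rw [Function.update_of_ne hb]
      refine le_trans ?_ (hC hab)
      rcases eq_or_ne a i with rfl | ha
      · rw [Function.update_self]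
        omega
      · rw [Function.update_of_ne ha]

theorem pathExponent_update {t : ℕ} (hkt : k ≤ t) {s : ℕ} {C : Fin k → ℕ} (hC : ∀ j, C j ≤ s)
    {j : Fin k} (hj : 0 < C j) :
    pathExponent t s C + Finsupp.single (Fin.natAdd t j) 1 =
      pathExponent t s (Function.update C j (C j - 1)) +
        Finsupp.single (Fin.castLE (Nat.le_add_left k t) j) 1 := by
  ext p
  have hs := hC j
  simp only [Finsupp.add_apply, pathExponent_apply, Finsupp.single_apply, Fin.ext_iff,
    Fin.val_natAdd, Fin.val_castLE, Function.update_apply]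
  have hp := p.2
  have hj' := j.2
  have h1 : ∀ h : p.val < k, p.val = j → C ⟨p, h⟩ = C j := fun h e => congrArg C (Fin.ext e)
  have h2 : ∀ h : p.val - t < k, t + j.val = p → C ⟨p - t, h⟩ = C j := fun h e =>
    congrArg C (Fin.ext (by dsimp only; omega))
  split_ifs with h3 <;> first
    | omega
    | (have := h1 ‹_› (by omega); omega)
    | (have := h2 (by omega) (by omega); omega)

/-- The colon ideal at the generator indexed by `C` is generated by the variables `x_{t + j}` for
those `j` at which `C` can be lowered by one. -/
def pathColon (t : ℕ) (C : Fin k → ℕ) : Set (Fin (t + k)) :=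
  {y | ∃ j : Fin k, y = Fin.natAdd t j ∧ 0 < C j ∧ Monotone (Function.update C j (C j - 1))}

/-- The sequence of an element of the index set, whose order is a linear extension of the pointwise
order. -/
def seq {s : ℕ} (C : LinearExtension (BoundedMonotone k s)) : Fin k → ℕ :=
  Subtype.val (p := fun C : Fin k → ℕ => Monotone C ∧ ∀ j, C j ≤ s) C

theorem monotone_seq {s : ℕ} (C : LinearExtension (BoundedMonotone k s)) : Monotone (seq C) :=
  (Subtype.prop (p := fun C : Fin k → ℕ => Monotone C ∧ ∀ j, C j ≤ s) C).1

theorem seq_le {s : ℕ} (C : LinearExtension (BoundedMonotone k s)) (j : Fin k) : seq C j ≤ s :=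
  (Subtype.prop (p := fun C : Fin k → ℕ => Monotone C ∧ ∀ j, C j ≤ s) C).2 j

theorem exists_seq_eq {s : ℕ} {C : Fin k → ℕ} (hC : Monotone C) (hs : ∀ j, C j ≤ s) :
    ∃ D : LinearExtension (BoundedMonotone k s), seq D = C :=
  ⟨toLinearExtension ⟨C, hC, hs⟩, rfl⟩

theorem le_of_seq_le {s : ℕ} {C D : LinearExtension (BoundedMonotone k s)} (h : seq C ≤ seq D) :
    C ≤ D :=
  (toLinearExtension (α := BoundedMonotone k s)).monotone (a := C) (b := D) h

/-- The generators of the `s`-th power of the path ideal, as a map from a free module. Their order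
is a linear extension of the pointwise order of the sequences `C`. -/
noncomputable def pathMap (K : Type*) [Field K] (k t s : ℕ) :
    (LinearExtension (BoundedMonotone k s) →₀ MvPolynomial (Fin (t + k)) K)
      →ₗ[MvPolynomial (Fin (t + k)) K] (Unit →₀ MvPolynomial (Fin (t + k)) K) :=
  Finsupp.linearCombination _ fun C : LinearExtension (BoundedMonotone k s) =>
    Finsupp.single () (monomial (pathExponent t s (seq C)) (1 : K))

theorem pathMap_single (K : Type*) [Field K] (k t s : ℕ)
    (C : LinearExtension (BoundedMonotone k s)) (f : MvPolynomial (Fin (t + k)) K) :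
    pathMap K k t s (Finsupp.single C f) =
      Finsupp.single () (f * monomial (pathExponent t s (seq C)) (1 : K)) := by
  rw [pathMap, Finsupp.linearCombination_single, Finsupp.smul_single, smul_eq_mul]

theorem pathMap_apply (K : Type*) [Field K] (k t s : ℕ)
    (v : LinearExtension (BoundedMonotone k s) →₀ MvPolynomial (Fin (t + k)) K) :
    pathMap K k t s v () = ∑ C ∈ v.support, v C * monomial (pathExponent t s (seq C)) (1 : K) := by
  rw [pathMap, Finsupp.linearCombination_apply, Finsupp.sum, Finsupp.finsetSum_apply]
  simp

theorem leadIdeal_ker_pathMap (K : Type*) [Field K] {t : ℕ} (hkt : k ≤ t) (s : ℕ)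
    (C : LinearExtension (BoundedMonotone k s)) :
    leadIdeal (LinearMap.ker (pathMap K k t s)) C = Ideal.span (X '' pathColon t (seq C)) := by
  classical
  apply le_antisymm
  · intro f hf
    obtain ⟨v, hv, hvs, rfl⟩ := mem_leadIdeal.1 hf
    have hsum : v C * monomial (pathExponent t s (seq C)) (1 : K) =
        -∑ D ∈ v.support.erase C, v D * monomial (pathExponent t s (seq D)) (1 : K) := by
      have h0 := pathMap_apply K k t s v
      rw [LinearMap.mem_ker.1 hv, Finsupp.zero_apply] at h0
      rw [eq_neg_iff_add_eq_zero, h0]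
      by_cases hC : C ∈ v.support
      · rw [Finset.add_sum_erase _
          (fun D => v D * monomial (pathExponent t s (seq D)) (1 : K)) hC]
      · rw [Finsupp.notMem_support_iff.1 hC, zero_mul, zero_add, Finset.erase_eq_of_notMem hC]
    have hmem : v C * monomial (pathExponent t s (seq C)) (1 : K) ∈
        Ideal.span ((fun e => monomial e (1 : K)) ''
          {e | ∃ D : LinearExtension (BoundedMonotone k s), D < C ∧ e = pathExponent t s (seq D)}) := by
      rw [hsum]
      refine neg_mem (Submodule.sum_mem _ fun D hD => Ideal.mul_mem_left _ _ ?_)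
      exact Ideal.subset_span ⟨_, ⟨D, lt_of_le_of_ne (hvs (Finset.mem_of_mem_erase hD))
        (Finset.ne_of_mem_erase hD), rfl⟩, rfl⟩
    rw [mem_ideal_span_X_image]
    rw [mem_ideal_span_monomial_image] at hmem
    intro m hm
    obtain ⟨_, ⟨D, hD, rfl⟩, hle⟩ := hmem (m + pathExponent t s (seq C)) (by
      rw [mem_support_iff, coeff_mul_monomial, mul_one]
      exact mem_support_iff.1 hm)
    have hnot : ∃ j, (seq D) j < (seq C) j := by
      by_contra! h
      exact not_le.2 hD (le_of_seq_le h)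
    obtain ⟨j, hj⟩ := hnot
    obtain ⟨i, hi, hmono⟩ := exists_monotone_update (monotone_seq C) (monotone_seq D) hj
    refine ⟨Fin.natAdd t i, ⟨i, rfl, by omega, hmono⟩, ?_⟩
    have h1 := hle (Fin.natAdd t i)
    have h2 := (seq_le C) i
    rw [Finsupp.add_apply, pathExponent_natAdd hkt, pathExponent_natAdd hkt] at h1
    omega
  · refine Ideal.span_le.2 ?_
    rintro _ ⟨_, ⟨j, rfl, hj, hmono⟩, rfl⟩
    have hle : Function.update (seq C) j ((seq C) j - 1) ≤ (seq C) := by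
      intro i
      rw [Function.update_apply]
      split_ifs with h
      · exact h ▸ Nat.sub_le _ _
      · exact le_rfl
    obtain ⟨D, hD⟩ := exists_seq_eq hmono fun i => (hle i).trans (seq_le C i)
    have hDC : D < C := by
      refine lt_of_le_of_ne (le_of_seq_le (hD ▸ hle)) fun h => ?_
      have h1 : seq C j = seq C j - 1 := by
        conv_lhs => rw [← h, hD, Function.update_self]
      omega
    refine mem_leadIdeal.2 ⟨Finsupp.single C (X (Fin.natAdd t j)) -
      Finsupp.single D (X (Fin.castLE (Nat.le_add_left k t) j)), ?_, ?_, ?_⟩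
    · rw [LinearMap.mem_ker, map_sub, pathMap_single, pathMap_single, sub_eq_zero, X, X,
        monomial_mul, monomial_mul, hD, add_comm (Finsupp.single _ 1),
        pathExponent_update hkt (seq_le C) hj, add_comm (Finsupp.single _ 1)]
    · exact Submodule.sub_mem _ (Finsupp.single_mem_supported _ _ (le_refl C))
        (Finsupp.single_mem_supported _ _ hDC.le)
    · rw [Finsupp.sub_apply, Finsupp.single_eq_same, Finsupp.single_eq_of_ne hDC.ne', sub_zero]

end Generators

/-! ### Paths in the path graph -/

section PathGraph

/-- A path in the path graph visits exactly the vertices between its ends. -/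
theorem pathGraph_support_toFinset {n : ℕ} {u v : Fin n} (p : (SimpleGraph.pathGraph n).Walk u v)
    (hp : p.IsPath) : p.support.toFinset = Finset.Icc (min u v) (max u v) := by
  induction p with
  | nil => simp
  | @cons u w v h p ih =>
    rw [SimpleGraph.Walk.cons_isPath_iff] at hp
    have ih := ih hp.1
    have hu : u ∉ Finset.Icc (min w v) (max w v) := by
      rw [← ih, List.mem_toFinset]
      exact hp.2
    rw [SimpleGraph.Walk.support_cons, List.toFinset_cons, ih]
    rw [SimpleGraph.pathGraph_adj] at h
    ext x
    simp only [Finset.mem_insert, Finset.mem_Icc, min_le_iff, le_max_iff, Fin.le_def,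
      Fin.ext_iff] at hu ⊢
    omega

theorem prod_X_eq_monomial {K σ : Type*} [Field K] [DecidableEq σ] (s : Finset σ) :
    ∏ i ∈ s, (X i : MvPolynomial σ K) = monomial (∑ i ∈ s, Finsupp.single i 1) 1 := by
  rw [monomial_sum_one]
  rfl

theorem sum_single_Icc_apply {n : ℕ} (a b p : Fin n) :
    (∑ i ∈ Finset.Icc a b, Finsupp.single i 1 : Fin n →₀ ℕ) p = if a ≤ p ∧ p ≤ b then 1 else 0 := by
  rw [Finsupp.finsetSum_apply]
  simp [Finsupp.single_apply]

theorem pathIdeal_pathGraph (K : Type*) [Field K] {k t : ℕ} (ht : 1 ≤ t) (hkt : k ≤ t) :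
    pathIdeal K (SimpleGraph.pathGraph (t + k)) t = monotoneIdeal K k t 1 := by
  classical
  have hprod : ∀ {u v : Fin (t + k)} (p : (SimpleGraph.pathGraph (t + k)).Walk u v), p.IsPath →
      (p.support.map (X : _ → MvPolynomial (Fin (t + k)) K)).prod =
        monomial (∑ i ∈ Finset.Icc (min u v) (max u v), Finsupp.single i 1) 1 := by
    intro u v p hp
    rw [← prod_X_eq_monomial, ← pathGraph_support_toFinset p hp,
      List.prod_toFinset _ hp.support_nodup]
  have hlen : ∀ {u v : Fin (t + k)} (p : (SimpleGraph.pathGraph (t + k)).Walk u v), p.IsPath →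
      p.length + 1 = (max u v).val + 1 - (min u v).val := by
    intro u v p hp
    rw [← SimpleGraph.Walk.length_support, ← List.toFinset_card_of_nodup hp.support_nodup,
      pathGraph_support_toFinset p hp, Fin.card_Icc]
  -- The sequence of the path that starts at the vertex `a` is the indicator of `a ≤ j`.
  have hexp : ∀ a b : Fin (t + k), b.val + 1 = a.val + t →
      (∑ i ∈ Finset.Icc a b, Finsupp.single i 1 : Fin (t + k) →₀ ℕ) =
        pathExponent t 1 fun j : Fin k => if a.val ≤ j.val then 1 else 0 := by
    intro a b hab
    ext p
    rw [sum_single_Icc_apply, pathExponent_apply]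
    simp only [Fin.le_def]
    have := b.2
    split_ifs <;> omega
  rw [pathIdeal, monotoneIdeal]
  congr 1
  ext f
  constructor
  · rintro ⟨u, v, p, hp, hpt, rfl⟩
    have hl := hlen p hp
    have hle : (min u v).val ≤ (max u v).val := min_le_max
    refine ⟨⟨fun j => if (min u v).val ≤ j.val then 1 else 0, ?_, ?_⟩, ?_⟩
    · intro i j hij
      have : i.val ≤ j.val := hij
      dsimp only
      split_ifs <;> omega
    · intro j
      dsimp only
      split_ifs <;> omega
    · rw [hprod p hp, hexp _ _ (by omega)]
  · rintro ⟨⟨C, hC, hC1⟩, rfl⟩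
    obtain ⟨a, ha, haC⟩ : ∃ a ≤ k, ∀ j : Fin k, C j = if a ≤ j.val then 1 else 0 := by
      by_cases h : ∃ m, ∃ hm : m < k, C ⟨m, hm⟩ ≠ 0
      · obtain ⟨hm, hne⟩ := Nat.find_spec h
        refine ⟨Nat.find h, hm.le, fun j => ?_⟩
        split_ifs with hj
        · have h1 : C ⟨Nat.find h, hm⟩ ≤ C j := hC hj
          have h2 := hC1 j
          omega
        · by_contra hne'
          exact hj (Nat.find_min' h ⟨j.2, hne'⟩)
      · push Not at h
        exact ⟨k, le_rfl, fun j => by rw [if_neg (by omega)]; exact h j j.2⟩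
    obtain ⟨p, hp⟩ := (SimpleGraph.pathGraph_preconnected (t + k)
      ⟨a, by omega⟩ ⟨a + t - 1, by omega⟩).exists_isPath
    have hmin : min (⟨a, by omega⟩ : Fin (t + k)) ⟨a + t - 1, by omega⟩ = ⟨a, by omega⟩ :=
      min_eq_left (by rw [Fin.le_def]; dsimp only; omega)
    have hmax : max (⟨a, by omega⟩ : Fin (t + k)) ⟨a + t - 1, by omega⟩ = ⟨a + t - 1, by omega⟩ :=
      max_eq_right (by rw [Fin.le_def]; dsimp only; omega)
    refine ⟨_, _, p, hp, ?_, ?_⟩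
    · rw [hlen p hp, hmin, hmax]
      dsimp only
      omega
    · rw [hprod p hp, hmin, hmax, hexp _ _ (by dsimp only; omega)]
      dsimp only
      congr 2
      exact congrArg _ (_root_.funext haC)

end PathGraph

/-! ### The regularity -/

section Regularity

/-- The first stage of the linear resolution of the `s`-th power of the path ideal. -/
noncomputable def pathStage (K : Type*) [Field K] {k t s : ℕ} (hkt : k ≤ t) (hts : 0 < t * s) :
    LinearStage K (Fin (t + k)) where
  target := Unit
  finite_target := inferInstance
  targetDeg := 0
  gen := LinearExtension (BoundedMonotone k s)
  finite_gen := inferInstanceAs (Finite (BoundedMonotone k s))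
  order := inferInstance
  deg := t * s
  targetDeg_lt := hts
  φ := pathMap K k t s
  homogeneous C := by
    intro _ m hm
    rw [pathMap_single, one_mul, Finsupp.single_eq_same] at hm
    rw [Finset.mem_singleton.1 (support_monomial_subset hm), degree_pathExponent hkt (seq_le C),
      add_zero]
  colon C := pathColon t (seq C)
  lead := leadIdeal_ker_pathMap K hkt s

theorem range_pathMap (K : Type*) [Field K] (k t s : ℕ) :
    LinearMap.range (pathMap K k t s) =
      Submodule.comap (Finsupp.lapply ()) (monotoneIdeal K k t s) := by
  apply le_antisymm
  · rintro _ ⟨v, rfl⟩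
    rw [Submodule.mem_comap, Finsupp.lapply_apply, pathMap_apply]
    exact Submodule.sum_mem _ fun C _ => Ideal.mul_mem_left _ _ (Ideal.subset_span ⟨⟨seq C, monotone_seq C, seq_le C⟩, rfl⟩)
  · intro v hv
    have hle : monotoneIdeal K k t s ≤
        Submodule.comap (Finsupp.lsingle ()) (LinearMap.range (pathMap K k t s)) := by
      refine Ideal.span_le.2 ?_
      rintro _ ⟨C, rfl⟩
      obtain ⟨D, hD⟩ := exists_seq_eq C.2.1 C.2.2
      refine ⟨Finsupp.single D 1, ?_⟩
      rw [pathMap_single, one_mul, hD]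
      rfl
    have hv' : v = Finsupp.lsingle (R := MvPolynomial (Fin (t + k)) K) () (v ()) := by
      ext u
      simp
    rw [hv']
    exact hle hv

/-- The projection `R → R ⧸ I`, on the free module with one basis element. -/
noncomputable def quotientAug {K σ : Type*} [Field K] (I : Ideal (MvPolynomial σ K)) :
    (Unit →₀ MvPolynomial σ K) →ₗ[MvPolynomial σ K] (MvPolynomial σ K ⧸ I) :=
  I.mkQ ∘ₗ Finsupp.lapply ()

theorem quotientAug_single {K σ : Type*} [Field K] (I : Ideal (MvPolynomial σ K))
    (f : MvPolynomial σ K) :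
    quotientAug I (Finsupp.single () f) = Ideal.Quotient.mkₐ K I f := by
  rw [quotientAug, LinearMap.comp_apply, Finsupp.lapply_apply, Finsupp.single_eq_same]
  rfl

theorem quotientAug_surjective {K σ : Type*} [Field K] (I : Ideal (MvPolynomial σ K)) :
    Function.Surjective (quotientAug I) := by
  intro y
  obtain ⟨f, rfl⟩ := Submodule.mkQ_surjective _ y
  exact ⟨Finsupp.single () f, by simp [quotientAug]⟩

theorem exists_homogeneous_quotientAug_eq {K σ : Type*} [Field K] {I : Ideal (MvPolynomial σ K)}
    {j : ℕ} {y : MvPolynomial σ K ⧸ I} (hy : y ∈ quotientGrading I j) :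
    ∃ v ∈ freeDegreePart K (fun _ => 0) j, quotientAug I v = y := by
  obtain ⟨f, hf, rfl⟩ := hy
  refine ⟨Finsupp.single () f, fun _ m hm => ?_, ?_⟩
  · rw [Finsupp.single_eq_same] at hm
    rw [add_zero, Finsupp.degree_eq_weight_one]
    exact hf (mem_support_iff.1 hm)
  · exact quotientAug_single I f

/-- If a nontrivial quotient `R ⧸ I` by a nonzero ideal is resolved, there is a basis element in
homological degree one. -/
theorem nonempty_idx_one {K σ : Type*} [Field K] {I : Ideal (MvPolynomial σ K)} (h0 : I ≠ ⊥)
    (h1 : I ≠ ⊤) (F : GradedFreeResolution (σ := σ) (quotientGrading I)) : Nonempty (F.idx 1) := by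
  by_contra hF
  rw [not_nonempty_iff] at hF
  have hinj : ∀ v, F.aug v = 0 → v = 0 := by
    intro v hv
    obtain ⟨w, rfl⟩ := (F.exact_aug v).1 hv
    rw [Subsingleton.elim w 0, map_zero]
  obtain ⟨f, hf, hf0⟩ := Submodule.exists_mem_ne_zero_of_ne_bot h0
  have hidx : IsEmpty (F.idx 0) := by
    refine ⟨fun k => hf0 ?_⟩
    obtain ⟨g, hg⟩ := Submodule.mkQ_surjective _ (F.aug (Finsupp.single k 1))
    have hz : F.aug (Finsupp.single k f) = 0 := by
      have : Finsupp.single k f = f • Finsupp.single k (1 : MvPolynomial σ K) := by simp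
      rw [this, map_smul, ← hg, ← map_smul, Submodule.mkQ_apply, Submodule.Quotient.mk_eq_zero]
      exact I.mul_mem_right _ hf
    simpa using hinj _ hz
  apply h1
  rw [Ideal.eq_top_iff_one]
  obtain ⟨v, hv⟩ := F.aug_surjective (I.mkQ 1)
  rw [Subsingleton.elim v 0, map_zero] at hv
  exact (Submodule.Quotient.mk_eq_zero _).1 hv.symm

end Regularity

theorem corollary2p2 (K : Type*) [Field K] (n t s : ℕ) (ht : 1 ≤ t) (htn : t ≤ n)
    (hnt : n ≤ 2 * t) (hs : 1 ≤ s) :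
    HasRegularity (Fin n)
      (quotientGrading ((pathIdeal K (SimpleGraph.pathGraph n) t) ^ s))
      ((t : ℤ) * (s : ℤ) - 1) := by
  obtain ⟨k, rfl⟩ := Nat.exists_eq_add_of_le htn
  have hkt : k ≤ t := by omega
  have hts : 0 < t * s := Nat.mul_pos ht hs
  rw [pathIdeal_pathGraph K ht hkt, ← monotoneIdeal_eq_pow]
  set I := monotoneIdeal K k t s with hI
  have hexact : Function.Exact (pathMap K k t s) (quotientAug I) := by
    rw [LinearMap.exact_iff, range_pathMap, quotientAug, LinearMap.ker_comp, Submodule.ker_mkQ]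
  let G : GradedFreeResolution (σ := Fin (t + k)) (quotientGrading I) :=
    (pathStage K hkt hts).resolution (quotientAug I)
      (fun _ => ⟨1, isHomogeneous_one _ _, (quotientAug_single I 1).symm⟩)
      (quotientAug_surjective I) hexact
  have hshift0 : ∀ l, G.shift 0 l = 0 := fun _ => rfl
  have hshift : ∀ i l, G.shift (i + 1) l = t * s + i := fun i _ =>
    LinearStage.deg_iter (pathStage K hkt hts) i
  refine ⟨⟨G, fun i => LinearStage.range_φ_le _⟩, fun F hF => ?_⟩
  have hcomp := hF.exists_shift_eq G fun j m hm => exists_homogeneous_quotientAug_eq hm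
  have hF1 : Nonempty (F.idx 1) := by
    refine nonempty_idx_one ?_ ?_ F
    · intro h
      have hmem : monomial (pathExponent t s fun _ : Fin k => 0) (1 : K) ∈ I :=
        Ideal.subset_span ⟨⟨fun _ => 0, monotone_const, fun _ => Nat.zero_le s⟩, rfl⟩
      rw [h, Ideal.mem_bot, monomial_eq_zero] at hmem
      exact one_ne_zero hmem
    · -- The generators have positive degree, so that they lie in the ideal of the variables.
      intro h
      have hle : I ≤ Ideal.span (Set.range X) := by
        refine Ideal.span_le.2 ?_
        rintro _ ⟨C, rfl⟩
        refine (mem_span_range_X_iff _).2 fun m hm h0 => ?_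
        have hdeg := degree_pathExponent hkt C.2.2
        rw [← Finset.mem_singleton.1 (support_monomial_subset hm), h0, map_zero] at hdeg
        omega
      rw [h, top_le_iff, Ideal.eq_top_iff_one, mem_span_range_X_iff] at hle
      exact hle 0 (by classical simp) rfl
  constructor
  · obtain ⟨k₁⟩ := hF1
    obtain ⟨l, hl⟩ := hcomp 1 k₁
    refine ⟨1, k₁, ?_⟩
    rw [← hl, hshift 0 l]
    push_cast
    ring
  · rintro q ⟨i, k₁, rfl⟩
    obtain ⟨l, hl⟩ := hcomp i k₁
    rw [← hl]
    cases i with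
    | zero =>
      rw [hshift0]
      have : (0 : ℤ) < (t : ℤ) * s := by exact_mod_cast hts
      push_cast
      omega
    | succ i =>
      rw [hshift]
      push_cast
      omega
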